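/- Let $\nu<\kappa$ be regular uncountable cardinals and let $\lambda$ be a cardinal with $\lambda\ge\kappa^{++}$. For a cardinal $\theta$ and a set $A$ of ordinals write $\mathcal P_\theta A=\{x\subseteq A:|x|<\theta\}$; a subset $C\subseteq\mathcal P_\theta A$ is unbounded if every $x\in\mathcal P_\theta A$ is contained in some $y\in C$. For an ordinal $\gamma$ let $\operatorname{cf}(\nu,\gamma)$ be the smallest size of an unbounded subset of $\mathcal P_\nu\gamma$. A subset of $\mathcal P_\kappa A$ is club if it is unbounded and closed under unions of nonempty $\subseteq$-chains of size less than $\kappa$, and a subset of $\mathcal P_\kappa A$ is stationary if it meets every club subset of $\mathcal P_\kappa A$. Assume that $\operatorname{cf}(\nu,\gamma)<\kappa$ for every ordinal $\gamma$ with $\nu<\gamma<\kappa$. Then $\mathcal P_\kappa\lambda$ has a $\kappa^+$-nonreflecting stationary subset, i.e. there is a stationary $S\subseteq\mathcal P_\kappa\lambda$ such that for every set $A$ with $\kappa^+\subseteq A\subseteq\lambda$ and $|A|=\kappa^+$, the set $S\cap\mathcal P_\kappa A$ is not stationary in $\mathcal P_\kappa A$. -/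

import Mathlib

universe u

namespace PkLambda

/-- `P_κ A`, the set of all subsets of `A` of size less than `κ`, for a set `A` of ordinals.
Sets of ordinals live one universe higher than the ordinals themselves are indexed by, hence
the lift. -/
def Pk (κ : Cardinal.{u}) (A : Set Ordinal.{u}) : Set (Set Ordinal.{u}) :=
  {x | x ⊆ A ∧ Cardinal.mk x < Cardinal.lift.{u + 1, u} κ}

/-- `C` is an unbounded (that is, cofinal with respect to inclusion) subset of `P_κ A`. -/
def IsUnboundedIn (κ : Cardinal.{u}) (A : Set Ordinal.{u}) (C : Set (Set Ordinal.{u})) : Prop :=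
  C ⊆ Pk κ A ∧ ∀ x ∈ Pk κ A, ∃ y ∈ C, x ⊆ y

/-- `C` is a club subset of `P_κ A`: it is unbounded, and closed under unions of nonempty
chains of size less than `κ`. -/
def IsClubIn (κ : Cardinal.{u}) (A : Set Ordinal.{u}) (C : Set (Set Ordinal.{u})) : Prop :=
  IsUnboundedIn κ A C ∧
    ∀ D : Set (Set Ordinal.{u}), D ⊆ C → D.Nonempty → IsChain (· ⊆ ·) D →
      Cardinal.mk D < Cardinal.lift.{u + 1, u} κ → ⋃₀ D ∈ C

/-- `S` is a stationary subset of `P_κ A`: it meets every club subset of `P_κ A`. -/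
def IsStationaryIn (κ : Cardinal.{u}) (A : Set Ordinal.{u}) (S : Set (Set Ordinal.{u})) : Prop :=
  S ⊆ Pk κ A ∧ ∀ C : Set (Set Ordinal.{u}), IsClubIn κ A C → (S ∩ C).Nonempty

/-- `cf(ν, γ)`, the smallest size of an unbounded subset of `P_ν γ`. The ordinal `γ` is
identified with the set of its predecessors. -/
noncomputable def cf (ν : Cardinal.{u}) (γ : Ordinal.{u}) : Cardinal.{u + 1} :=
  sInf {c | ∃ C : Set (Set Ordinal.{u}), IsUnboundedIn ν (Set.Iio γ) C ∧ Cardinal.mk C = c}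

/-- `S` is a `μ`-nonreflecting stationary subset of `P_κ lam`: it is stationary, and for every
`A` with `μ ⊆ A ⊆ lam` of size `μ`, the set `S ∩ P_κ A` is not stationary in `P_κ A`. -/
def IsNonreflectingStationary (κ lam μ : Cardinal.{u}) (S : Set (Set Ordinal.{u})) : Prop :=
  IsStationaryIn κ (Set.Iio lam.ord) S ∧
    ∀ A : Set Ordinal.{u}, Set.Iio μ.ord ⊆ A → A ⊆ Set.Iio lam.ord →
      Cardinal.mk A = Cardinal.lift.{u + 1, u} μ → ¬ IsStationaryIn κ A (S ∩ Pk κ A)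

end PkLambda

open Cardinal Set Ordinal

universe v

/-! The witness asks that $x\cap\kappa$ and $x\cap\kappa^+$ be countably directed, that
$x\cap\kappa^{++}$ not be, and that $x\cap\kappa^{++}$ not be covered by $g_\delta[x\cap\kappa^+]$,
where $\delta=\sup(x\cap\kappa^{++})$.

Nonreflection. Let $\mu\le\kappa^+$ be the least size of a cofinal subset of $A'=A\cap\kappa^{++}$.
If $\mu$ is $\kappa$ or $\kappa^+$, then club many $x$ transfer countable directedness from
$x\cap\mu$ to $x\cap A'$. If $\mu<\kappa$, then club many $x$ contain a fixed cofinal subset of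
$A'$, so their supremum is $\sup A'$, and closure under preimages makes them covered. In both cases
a club misses the witness (`not_isStationaryIn_nonreflectingSet`).

Stationarity. A club contains all small sets closed under some operation `F`
(`IsClubIn.exists_operation`). For every countable $b$, one of only $\kappa^+$ traces $y$ satisfies:
the hull of $b\cup y$ adds nothing to $y$ below $\kappa^+$ (`exists_trace`). Since
$\kappa^+<\kappa^{++}$, a diagonal play yields a single $y$ against which no violation can be forced
(`exists_not_canForceViolation`). Playing $\omega$ moves while keeping this property gives $x$ with
$x\cap\kappa^+=y$ and $x\cap\kappa^{++}$ of countable cofinality. The supremum $\delta$ is fixed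
before the first move, for which $\kappa$ candidates remain; as $|y|<\kappa$, one of them escapes
$g_\delta[y]$. -/

namespace PkLambda

/-! ### Hulls under set-valued operations -/

section Hull

variable {α : Type v}

/-- `x` is closed under the set-valued operation `F` on finite sets. -/
def IsClosedUnder (F : Finset α → Set α) (x : Set α) : Prop :=
  ∀ e : Finset α, ↑e ⊆ x → F e ⊆ x

/-- The smallest superset of `z` closed under `F`. -/
def hull (F : Finset α → Set α) (z : Set α) : Set α :=
  ⋂₀ {x | IsClosedUnder F x ∧ z ⊆ x}

theorem subset_hull (F : Finset α → Set α) (z : Set α) : z ⊆ hull F z :=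
  subset_sInter fun _ hx => hx.2

theorem hull_subset {F : Finset α → Set α} {z x : Set α} (hx : IsClosedUnder F x) (hz : z ⊆ x) :
    hull F z ⊆ x :=
  sInter_subset_of_mem ⟨hx, hz⟩

theorem isClosedUnder_hull (F : Finset α → Set α) (z : Set α) : IsClosedUnder F (hull F z) :=
  fun e he => subset_sInter fun _ hx => hx.1 e (he.trans (hull_subset hx.1 hx.2))

theorem hull_mono (F : Finset α → Set α) {z w : Set α} (h : z ⊆ w) : hull F z ⊆ hull F w :=
  hull_subset (isClosedUnder_hull F w) (h.trans (subset_hull F w))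

theorem isClosedUnder_sUnion {F : Finset α → Set α} {D : Set (Set α)} (hne : D.Nonempty)
    (hD : DirectedOn (· ⊆ ·) D) (h : ∀ x ∈ D, IsClosedUnder F x) : IsClosedUnder F (⋃₀ D) := by
  intro e he
  obtain ⟨x, hx, hex⟩ :=
    hD.exists_mem_subset_of_finite_of_subset_sUnion hne e.finite_toSet he
  exact (h x hx e hex).trans (subset_sUnion_of_mem hx)

theorem isClosedUnder_iUnion_nat {F : Finset α → Set α} {f : ℕ → Set α} (hf : Monotone f)
    (h : ∀ n, IsClosedUnder F (f n)) : IsClosedUnder F (⋃ n, f n) := by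
  rw [← sUnion_range]
  refine isClosedUnder_sUnion (range_nonempty f) ?_ (by rintro _ ⟨n, rfl⟩; exact h n)
  rintro _ ⟨m, rfl⟩ _ ⟨n, rfl⟩
  exact ⟨f (max m n), ⟨_, rfl⟩, hf (le_max_left _ _), hf (le_max_right _ _)⟩

theorem mk_finsets_le (s : Set α) : #{e : Finset α | ↑e ⊆ s} ≤ max ℵ₀ #s := by
  classical
  have h : {e : Finset α | ↑e ⊆ s} ⊆ range fun l : List s => (l.map Subtype.val).toFinset := by
    intro e he
    refine ⟨e.toList.attach.map fun a => ⟨a.1, he (by simpa using a.2)⟩, ?_⟩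
    ext a
    simp
  exact ((mk_le_mk_of_subset h).trans mk_range_le).trans (mk_list_le_max _)

theorem mk_iUnion_lt {ι : Type v} {K : Cardinal.{v}} (hK : K.IsRegular) (hι : #ι < K)
    {f : ι → Set α} (h : ∀ i, #(f i) < K) : #(⋃ i, f i) < K :=
  (card_iUnion_lt_iff_forall_of_isRegular hK hι).2 h

theorem mk_biUnion_lt {ι : Type v} {K : Cardinal.{v}} (hK : K.IsRegular) {s : Set ι} (hs : #s < K)
    {f : ι → Set α} (h : ∀ i ∈ s, #(f i) < K) : #(⋃ i ∈ s, f i) < K :=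
  (card_biUnion_lt_iff_forall_of_isRegular hK hs).2 h

theorem mk_iUnion_nat_lt {K : Cardinal.{v}} (hK : K.IsRegular) (hK' : ℵ₀ < K)
    {f : ℕ → Set α} (h : ∀ i, #(f i) < K) : #(⋃ i, f i) < K := by
  have : (⋃ i, f i) = ⋃ i : ULift.{v} ℕ, f i.down := by
    ext; simp [ULift.exists]
  rw [this]
  exact mk_iUnion_lt hK (by simpa) fun i => h _

theorem mk_union_lt {K : Cardinal.{v}} (hK : ℵ₀ ≤ K) {s t : Set α} (hs : #s < K) (ht : #t < K) :
    #(s ∪ t : Set α) < K :=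
  (mk_union_le s t).trans_lt (add_lt_of_lt hK hs ht)

theorem mk_hull_lt {K : Cardinal.{v}} (hK : K.IsRegular) (hK' : ℵ₀ < K)
    {F : Finset α → Set α} (hF : ∀ e, #(F e) < K) {z : Set α} (hz : #z < K) :
    #(hull F z) < K := by
  let step : Set α → Set α := fun s => s ∪ ⋃ e ∈ {e : Finset α | ↑e ⊆ s}, F e
  let it : ℕ → Set α := fun n => step^[n] z
  have hit : ∀ n, it (n + 1) = step (it n) := fun n => Function.iterate_succ_apply' step n z
  have hmono : Monotone it := by
    refine monotone_nat_of_le_succ fun n => ?_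
    rw [hit]
    exact subset_union_left
  have hcard : ∀ n, #(it n) < K := by
    intro n
    induction n with
    | zero => exact hz
    | succ n ih =>
      rw [hit]
      exact mk_union_lt hK'.le ih (mk_biUnion_lt hK
        ((mk_finsets_le _).trans_lt (max_lt hK' ih)) fun e _ => hF e)
  refine (mk_le_mk_of_subset (hull_subset (x := ⋃ n, it n) ?_ ?_)).trans_lt
    (mk_iUnion_nat_lt hK hK' hcard)
  · intro e he
    rw [← sUnion_range] at he
    obtain ⟨_, ⟨n, rfl⟩, hn⟩ := DirectedOn.exists_mem_subset_of_finite_of_subset_sUnion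
      (range_nonempty it) (by
        rintro _ ⟨m, rfl⟩ _ ⟨n, rfl⟩
        exact ⟨it (max m n), ⟨_, rfl⟩, hmono (le_max_left _ _), hmono (le_max_right _ _)⟩)
      e.finite_toSet he
    refine subset_trans ?_ (subset_iUnion it (n + 1))
    rw [hit]
    exact subset_union_of_subset_right (subset_biUnion_of_mem (u := F) hn) _
  · exact subset_iUnion it 0

/-- The hull of an increasing union of `ℕ`-many sets is the union of the hulls. -/
theorem hull_iUnion_nat (F : Finset α → Set α) {f : ℕ → Set α} (hf : Monotone f) :
    hull F (⋃ n, f n) = ⋃ n, hull F (f n) := by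
  refine subset_antisymm (hull_subset (isClosedUnder_iUnion_nat (fun m n h => hull_mono F (hf h))
    fun n => isClosedUnder_hull F _) (iUnion_mono fun n => subset_hull F _)) ?_
  exact iUnion_subset fun n => hull_mono F (subset_iUnion f n)

end Hull

/-! ### Clubs and operations on finite sets -/

theorem mem_Pk {κ : Cardinal.{u}} {A x : Set Ordinal.{u}} :
    x ∈ Pk κ A ↔ x ⊆ A ∧ #x < Cardinal.lift.{u + 1, u} κ := Iff.rfl

theorem aleph0_lt_lift {κ : Cardinal.{u}} (h : ℵ₀ < κ) : ℵ₀ < Cardinal.lift.{u + 1, u} κ := by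
  rw [← lift_aleph0.{u + 1, u}]
  exact lift_lt.2 h

/-- The sets of size less than `κ` closed under a given small-valued operation and containing a
given small set form a club. -/
theorem isClubIn_isClosedUnder {κ : Cardinal.{u}} (hκ : κ.IsRegular) (hκ' : ℵ₀ < κ)
    {A : Set Ordinal.{u}} {F : Finset Ordinal.{u} → Set Ordinal.{u}}
    (hF : ∀ e : Finset Ordinal.{u}, F e ∈ Pk κ A) :
    IsClubIn κ A {x | x ∈ Pk κ A ∧ IsClosedUnder F x} := by
  have hκl := IsRegular.lift.{u + 1} hκ
  refine ⟨⟨fun x hx => hx.1, fun x hx => ⟨hull F x, ⟨⟨?_, ?_⟩, isClosedUnder_hull F x⟩,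
    subset_hull F x⟩⟩, ?_⟩
  · exact hull_subset (fun e _ => (hF e).1) hx.1
  · exact mk_hull_lt hκl (aleph0_lt_lift hκ') (fun e => (hF e).2) hx.2
  · intro D hD hne hch hcard
    refine ⟨⟨sUnion_subset fun x hx => (hD hx).1.1, ?_⟩,
      isClosedUnder_sUnion hne hch.directedOn fun x hx => (hD hx).2⟩
    rw [sUnion_eq_biUnion]
    exact mk_biUnion_lt hκl hcard fun x hx => (hD hx).1.2

/-- The union of the values of a monotone operation with values in a club, over the finite subsets
of a small set, belongs to the club. -/
theorem IsClubIn.iUnion_finset_mem {κ : Cardinal.{u}}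
    {A : Set Ordinal.{u}} {C : Set (Set Ordinal.{u})} (hC : IsClubIn κ A C)
    {F : Finset Ordinal.{u} → Set Ordinal.{u}}
    (hF : ∀ e : Finset Ordinal.{u}, ↑e ⊆ A → F e ∈ C)
    (hmono : ∀ e e' : Finset Ordinal.{u}, ↑e' ⊆ A → e ⊆ e' → F e ⊆ F e') :
    ∀ (m : Cardinal.{u + 1}) (s : Set Ordinal.{u}), #s = m → s ∈ Pk κ A →
      (⋃ e ∈ {e : Finset Ordinal.{u} | ↑e ⊆ s}, F e) ∈ C := by
  intro m
  induction m using WellFoundedLT.induction with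
  | _ m ih =>
  intro s hs hsA
  obtain hfin | hinf := s.finite_or_infinite
  · have : (⋃ e ∈ {e : Finset Ordinal.{u} | ↑e ⊆ s}, F e) = F hfin.toFinset := by
      refine subset_antisymm (iUnion₂_subset fun e he => hmono _ _ (by simpa using hsA.1) ?_)
        (subset_biUnion_of_mem (u := F) (by simp))
      simpa [← Finset.coe_subset] using he
    rw [this]
    exact hF _ (by simpa using hsA.1)
  have hm : ℵ₀ ≤ m := by rw [← hs]; exact aleph0_le_mk_iff.2 hinf.to_subtype
  -- In an enumeration of minimal order type the initial segments are smaller than `s`, so the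
  -- induction hypothesis applies to them; their values form a chain with union `G s`.
  obtain ⟨φ⟩ : Nonempty (s ≃ m.ord.ToType) := by
    rw [← Cardinal.eq, mk_ord_toType, hs]
  let t : m.ord.ToType → Set Ordinal.{u} := fun i => Subtype.val '' (φ ⁻¹' Iic i)
  have ht : ∀ i, t i ⊆ s := by
    rintro i _ ⟨a, _, rfl⟩
    exact a.2
  have htmono : Monotone t := fun i j hij => image_mono (preimage_mono (Iic_subset_Iic.2 hij))
  have htcard : ∀ i, #(t i) < m := by
    intro i
    refine mk_image_le.trans_lt ?_
    rw [mk_preimage_equiv]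
    have := mk_Iic_lt i (by simp) (by simpa using hm)
    simpa using this
  let G : Set Ordinal.{u} → Set Ordinal.{u} :=
    fun s => ⋃ e ∈ {e : Finset Ordinal.{u} | ↑e ⊆ s}, F e
  have hGmono : Monotone G := fun a b hab =>
    biUnion_mono (fun e he => subset_trans he hab) fun _ _ => subset_rfl
  have hmem : ∀ i, G (t i) ∈ C := fun i =>
    ih _ (htcard i) (t i) rfl ⟨(ht i).trans hsA.1, (htcard i).trans (hs ▸ hsA.2)⟩
  have hne : Nonempty m.ord.ToType := by
    rw [← mk_ne_zero_iff, mk_ord_toType]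
    exact (aleph0_pos.trans_le hm).ne'
  have hU : G s = ⋃₀ range fun i => G (t i) := by
    refine subset_antisymm ?_ (sUnion_subset ?_)
    · refine iUnion₂_subset fun e he => ?_
      replace he : (↑e : Set Ordinal.{u}) ⊆ s := he
      have : ∃ i, ↑e ⊆ t i := by
        obtain ⟨i, hi⟩ := (e.attach.image fun a : {a // a ∈ e} =>
          φ ⟨a.1, he a.2⟩).exists_le
        refine ⟨i, fun a ha => ⟨⟨a, he ha⟩, hi _ ?_, rfl⟩⟩
        exact Finset.mem_image.2 ⟨⟨a, ha⟩, Finset.mem_attach _ _, rfl⟩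
      obtain ⟨i, hi⟩ := this
      exact subset_trans (subset_biUnion_of_mem (u := F) hi)
        (subset_sUnion_of_mem (mem_range_self (f := fun i => G (t i)) i))
    · rintro _ ⟨i, rfl⟩
      exact hGmono (ht i)
  change G s ∈ C
  rw [hU]
  refine hC.2 _ (by rintro _ ⟨i, rfl⟩; exact hmem i) (range_nonempty _) ?_ ?_
  · rintro _ ⟨i, rfl⟩ _ ⟨j, rfl⟩ _
    exact (le_total i j).imp (fun h => hGmono (htmono h)) fun h => hGmono (htmono h)
  · refine mk_range_le.trans_lt ?_
    rw [mk_ord_toType, ← hs]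
    exact hsA.2

/-- An operation on finite sets which picks, above every finite set and the values at its proper
subsets, a value of `c`. -/
def cumulative {α : Type v} (c : Set α → Set α) (e : Finset α) : Set α :=
  c (↑e ∪ ⋃ d : {d : Finset α // d ⊂ e}, cumulative c d.1)
termination_by e.card
decreasing_by exact Finset.card_lt_card d.2

/-- Every club contains all small sets closed under some operation on finite sets. -/
theorem IsClubIn.exists_operation {κ : Cardinal.{u}} (hκ : κ.IsRegular) (hκ' : ℵ₀ < κ)
    {A : Set Ordinal.{u}} {C : Set (Set Ordinal.{u})} (hC : IsClubIn κ A C) :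
    ∃ F : Finset Ordinal.{u} → Set Ordinal.{u}, (∀ e, F e ∈ Pk κ A) ∧
      ∀ x ∈ Pk κ A, IsClosedUnder F x → x ∈ C := by
  classical
  have hκl := IsRegular.lift.{u + 1} hκ
  have h0 := aleph0_lt_lift hκ'
  choose! c hcC hc using hC.1.2
  have key : ∀ e : Finset Ordinal.{u}, ↑e ⊆ A →
      (↑e ∪ ⋃ d : {d : Finset Ordinal.{u} // d ⊂ e}, cumulative c d.1) ∈ Pk κ A := by
    intro e
    induction e using Finset.strongInduction with
    | H e ih =>
    intro he
    have hd : ∀ d : {d : Finset Ordinal.{u} // d ⊂ e}, cumulative c d.1 ∈ Pk κ A := by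
      intro d
      have := ih d.1 d.2 (subset_trans (Finset.coe_subset.2 d.2.subset) he)
      rw [cumulative]
      exact hC.1.1 (hcC _ this)
    refine ⟨union_subset he (iUnion_subset fun d => (hd d).1), mk_union_lt h0.le
      ((lt_aleph0_of_finite _).trans h0) (mk_iUnion_lt hκl ?_ fun d => (hd d).2)⟩
    have : Finite {d : Finset Ordinal.{u} // d ⊂ e} :=
      Finite.of_injective (β := {d // d ∈ e.powerset})
        (fun d => ⟨d.1, Finset.mem_powerset.2 d.2.subset⟩) fun a b h => by
          simpa [Subtype.ext_iff] using h
    exact (lt_aleph0_of_finite _).trans h0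
  have hmem : ∀ e : Finset Ordinal.{u}, ↑e ⊆ A → cumulative c e ∈ C := by
    intro e he
    rw [cumulative]
    exact hcC _ (key e he)
  have hsub : ∀ e : Finset Ordinal.{u}, ↑e ⊆ A → ↑e ⊆ cumulative c e := by
    intro e he
    rw [cumulative]
    exact subset_union_left.trans (hc _ (key e he))
  have hmono : ∀ e e' : Finset Ordinal.{u}, ↑e' ⊆ A → e ⊆ e' →
      cumulative c e ⊆ cumulative c e' := by
    intro e e' he' hee'
    obtain rfl | hss := hee'.eq_or_ssubset
    · rfl
    · conv_rhs => rw [cumulative]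
      refine subset_trans ?_ (hc _ (key e' he'))
      exact subset_union_of_subset_right
        (subset_iUnion (fun d : {d : Finset Ordinal.{u} // d ⊂ e'} => cumulative c d.1) ⟨e, hss⟩) _
  -- The value `∅` off `A` keeps every value in `Pk κ A`. A closed `x` is the union of the values at
  -- its finite subsets, hence lies in `C`.
  refine ⟨fun e => if ↑e ⊆ A then cumulative c e else ∅, fun e => ?_, fun x hx hcl => ?_⟩
  · by_cases he : ↑e ⊆ A
    · simpa [he] using hC.1.1 (hmem e he)
    · simpa [he, mem_Pk] using aleph0_pos.trans h0
  · convert hC.iUnion_finset_mem hmem hmono _ x rfl hx using 1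
    refine subset_antisymm (fun a ha => ?_) (iUnion₂_subset fun e he => ?_)
    · exact mem_biUnion (x := {a}) (by simpa using ha)
        (hsub {a} (by simpa using hx.1 ha) (by simp))
    · have := hcl e he
      simpa [subset_trans (show ↑e ⊆ x from he) hx.1] using this

/-! ### Bounds and closure points below regular cardinals -/

theorem mk_Iio_lt_lift {μ : Cardinal.{u}} {ρ : Ordinal.{u}} (h : ρ < μ.ord) :
    #(Iio ρ) < Cardinal.lift.{u + 1} μ := by
  rw [Cardinal.mk_Iio_ordinal]
  exact lift_lt.2 (lt_ord.1 h)

theorem mk_Iio_ord (μ : Cardinal.{u}) : #(Iio μ.ord) = Cardinal.lift.{u + 1} μ := by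
  rw [Cardinal.mk_Iio_ordinal, card_ord]

theorem exists_bound_of_cof {γ : Ordinal.{u}} {s : Set Ordinal.{u}} (hs : s ⊆ Iio γ)
    (hcard : #s < Cardinal.lift.{u + 1} γ.cof) : ∃ ρ < γ, ∀ a ∈ s, a < ρ := by
  refine ⟨sSup ((· + 1) '' s), sSup_add_one_lt_of_lt_cof (by rwa [← lift_cof]) hs, fun a ha => ?_⟩
  refine (lt_add_one a).trans_le (le_csSup ⟨γ, ?_⟩ (mem_image_of_mem _ ha))
  rintro _ ⟨b, hb, rfl⟩
  exact Order.add_one_le_of_lt (hs hb)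

theorem exists_bound {μ : Cardinal.{u}} (hμ : μ.IsRegular) {s : Set Ordinal.{u}}
    (hs : s ⊆ Iio μ.ord) (hcard : #s < Cardinal.lift.{u + 1} μ) :
    ∃ ρ < μ.ord, ∀ a ∈ s, a < ρ :=
  exists_bound_of_cof hs (by rwa [hμ.cof_ord])

/-- Below a regular cardinal `μ` there are closure points of any function, of any smaller regular
cofinality. -/
theorem exists_closure_point {χ μ : Cardinal.{u}} (hχ : χ.IsRegular) (hμ : μ.IsRegular)
    (hχμ : χ < μ) {f : Ordinal.{u} → Ordinal.{u}} (hf : ∀ ρ < μ.ord, f ρ < μ.ord)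
    {a : Ordinal.{u}} (ha : a < μ.ord) :
    ∃ γ < μ.ord, a < γ ∧ γ.cof = χ ∧ ∀ ρ < γ, f ρ < γ := by
  let g : Ordinal.{u} → Ordinal.{u} := fun ρ => sSup ((fun i => max (f i) a + 1) '' Iic ρ)
  have hbdd : ∀ ρ, BddAbove ((fun i => max (f i) a + 1) '' Iic ρ) := fun ρ => bddAbove_of_small
  have hgmono : Monotone g := fun ρ σ h =>
    csSup_le_csSup (hbdd σ) ⟨_, mem_image_of_mem _ self_mem_Iic⟩
      (image_mono (Iic_subset_Iic.2 h))
  have hfg : ∀ ρ, max (f ρ) a < g ρ := fun ρ =>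
    (lt_add_one _).trans_le (le_csSup (hbdd ρ) (mem_image_of_mem _ self_mem_Iic))
  have hlim := isSuccLimit_ord hμ.aleph0_le
  have hg : ∀ ρ < μ.ord, g ρ < μ.ord := by
    intro ρ hρ
    have hρ' : Iic ρ = Iio (Order.succ ρ) := by ext; simp
    obtain ⟨σ, hσ, hσ'⟩ := exists_bound hμ (s := (fun i => max (f i) a + 1) '' Iic ρ) (by
        rintro _ ⟨i, hi, rfl⟩
        exact hlim.add_one_lt (max_lt (hf i (lt_of_le_of_lt hi hρ)) ha)) (by
        refine mk_image_le.trans_lt ?_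
        rw [hρ']
        exact mk_Iio_lt_lift (hlim.succ_lt hρ))
    refine lt_of_le_of_lt (csSup_le ⟨_, mem_image_of_mem _ self_mem_Iic⟩ fun b hb => ?_) hσ
    exact (hσ' b hb).le
  have hne : μ ≠ ℵ₀ := (hχ.aleph0_le.trans_lt hχμ).ne'
  have hχlim := isSuccLimit_ord hχ.aleph0_le
  -- `g` need not be normal, so its derivative need not enumerate fixed points. It suffices that
  -- each successor value dominates `g` at all earlier values.
  have hcl : ∀ ρ < Ordinal.deriv g χ.ord, max (f ρ) a < Ordinal.deriv g χ.ord := by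
    intro ρ hρ
    obtain ⟨o, ho, ho'⟩ := ((isNormal_deriv g).lt_iff_exists_lt hχlim).1 hρ
    refine (hfg ρ).trans_le ?_
    refine (hgmono (ho'.le.trans (Order.le_succ _))).trans ?_
    refine le_trans ?_ (deriv_strictMono g (hχlim.succ_lt ho)).le
    rw [deriv_succ]
    exact iterate_le_nfp g _ 1
  refine ⟨Ordinal.deriv g χ.ord, deriv_lt_ord hμ hne hg (ord_lt_ord.2 hχμ), ?_, ?_, fun ρ hρ =>
    (le_max_left _ _).trans_lt (hcl ρ hρ)⟩
  · have h0 : 0 < Ordinal.deriv g χ.ord :=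
      hχ.ord_pos.trans_le ((deriv_strictMono g).le_apply)
    exact (le_max_right _ _).trans_lt (hcl 0 h0)
  · rw [cof_map_of_isNormal (isNormal_deriv g) hχlim, hχ.cof_ord]

/-! ### The witness and its failure to reflect -/

/-- Every countable subset of `z` has an upper bound in `z`. -/
def IsCountablyDirected (z : Set Ordinal.{u}) : Prop :=
  ∀ s ⊆ z, s.Countable → ∃ ρ ∈ z, ∀ a ∈ s, a ≤ ρ

/-- The traces of `x` on `κ` and `κ⁺` are countably directed, the trace on `κ⁺⁺` is not, and the
latter is not covered by the image of `x ∩ κ⁺` under the function `g δ` attached to its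
supremum `δ`. -/
def nonreflectingSet (κ lam : Cardinal.{u}) (g : Ordinal.{u} → Ordinal.{u} → Ordinal.{u}) :
    Set (Set Ordinal.{u}) :=
  {x | x ∈ Pk κ (Iio lam.ord) ∧ IsCountablyDirected (x ∩ Iio κ.ord) ∧
    IsCountablyDirected (x ∩ Iio (Order.succ κ).ord) ∧
    ¬ IsCountablyDirected (x ∩ Iio (Order.succ (Order.succ κ)).ord) ∧
    ∀ δ, IsLUB (x ∩ Iio (Order.succ (Order.succ κ)).ord) δ →
      ¬ x ∩ Iio (Order.succ (Order.succ κ)).ord ⊆ g δ '' (x ∩ Iio (Order.succ κ).ord)}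

theorem exists_surjections (κ : Cardinal.{u}) :
    ∃ g : Ordinal.{u} → Ordinal.{u} → Ordinal.{u}, ∀ δ < (Order.succ κ).ord, ∀ a < δ,
      ∃ ξ < κ.ord, g δ ξ = a := by
  have key : ∀ δ : Ordinal.{u}, ∃ g : Ordinal.{u} → Ordinal.{u}, δ < (Order.succ κ).ord →
      ∀ a < δ, ∃ ξ < κ.ord, g ξ = a := by
    intro δ
    by_cases hδ : δ < (Order.succ κ).ord
    · have hle : #(Iio δ) ≤ #(Iio κ.ord) := by
        rw [mk_Iio_ord, Cardinal.mk_Iio_ordinal]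
        exact lift_le.2 (Order.lt_succ_iff.1 (lt_ord.1 hδ))
      obtain ⟨φ⟩ := hle
      refine ⟨Function.extend (fun a => (φ a : Ordinal.{u})) Subtype.val id,
        fun _ a ha => ⟨φ ⟨a, ha⟩, (φ ⟨a, ha⟩).2, ?_⟩⟩
      exact (Subtype.val_injective.comp φ.injective).extend_apply _ _ _
    · exact ⟨id, fun h => absurd h hδ⟩
  choose g hg using key
  exact ⟨g, hg⟩

/-- Let `x` be closed under `r`, sending a point of `A'` to the index of a member of `B` above it,
and under `f`, sending an index to a point of `A'` above all members of `B` indexed so far. A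
countable subset of `x ∩ A'` is bounded by moving it to `μ` by `r`, bounding it there, and returning
by `f`. -/
theorem not_isStationaryIn_of_isCountablyDirected {κ μ : Cardinal.{u}} (hκ : κ.IsRegular)
    (hκ' : ℵ₀ < κ) {A A' B : Set Ordinal.{u}} (hμA : Iio μ.ord ⊆ A) (hA' : A' ⊆ A)
    (hBA : B ⊆ A') (hB : ∀ a ∈ A', ∃ b ∈ B, a ≤ b) (hBμ : #B = Cardinal.lift.{u + 1} μ)
    (hmin : ∀ D ⊆ A', #D < Cardinal.lift.{u + 1} μ → ∃ a ∈ A', ∀ b ∈ D, b < a)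
    (hμ : ℵ₀ ≤ μ)
    {S : Set (Set Ordinal.{u})} (hS₁ : ∀ x ∈ S, IsCountablyDirected (x ∩ Iio μ.ord))
    (hS₂ : ∀ x ∈ S, ¬ IsCountablyDirected (x ∩ A')) : ¬ IsStationaryIn κ A S := by
  rintro ⟨-, hst⟩
  obtain ⟨φ⟩ : Nonempty (Iio μ.ord ≃ B) := by rw [← Cardinal.eq, mk_Iio_ord, hBμ]
  have hf : ∀ η : Ordinal.{u}, ∃ a, η < μ.ord →
      a ∈ A' ∧ ∀ ζ : Iio μ.ord, ζ.1 ≤ η → (φ ζ : Ordinal.{u}) < a := by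
    intro η
    by_cases hη : η < μ.ord
    · obtain ⟨a, ha, hba⟩ := hmin ((fun ζ => (φ ζ : Ordinal.{u})) '' {ζ : Iio μ.ord | ζ.1 ≤ η})
        (by rintro _ ⟨ζ, -, rfl⟩; exact hBA (φ ζ).2) (by
          refine mk_image_le.trans_lt ?_
          refine lt_of_le_of_lt ?_ (mk_Iio_lt_lift ((isSuccLimit_ord hμ).succ_lt hη))
          refine mk_le_of_injective (f := fun ζ => ⟨ζ.1.1, mem_Iio.2 (Order.lt_succ_of_le ζ.2)⟩) ?_
          intro a b hab
          exact Subtype.ext (Subtype.ext (by simpa using hab)))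
      exact ⟨a, fun _ => ⟨ha, fun ζ hζ => hba _ ⟨ζ, hζ, rfl⟩⟩⟩
    · exact ⟨0, fun h => absurd h hη⟩
  choose f hf using hf
  have hr : ∀ a : Ordinal.{u}, ∃ ζ : Ordinal.{u}, a ∈ A' →
      ∃ h : ζ < μ.ord, a ≤ φ ⟨ζ, h⟩ := by
    intro a
    by_cases ha : a ∈ A'
    · obtain ⟨b, hb, hab⟩ := hB a ha
      refine ⟨φ.symm ⟨b, hb⟩, fun _ => ⟨(φ.symm ⟨b, hb⟩).2, ?_⟩⟩
      simpa using hab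
    · exact ⟨0, fun h => absurd h ha⟩
  choose r hr using hr
  let F : Finset Ordinal.{u} → Set Ordinal.{u} :=
    fun e => f '' (↑e ∩ Iio μ.ord) ∪ r '' (↑e ∩ A')
  have hF : ∀ e, F e ∈ Pk κ A := by
    refine fun e => ⟨union_subset ?_ ?_, ?_⟩
    · rintro _ ⟨η, hη, rfl⟩
      exact hA' (hf η hη.2).1
    · rintro _ ⟨a, ha, rfl⟩
      exact hμA (hr a ha.2).1
    · refine lt_trans ?_ (aleph0_lt_lift hκ')
      exact (((e.finite_toSet.inter_of_left _).image _).union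
        ((e.finite_toSet.inter_of_left _).image _)).lt_aleph0
  obtain ⟨x, hxS, hx, hxF⟩ := hst _ (isClubIn_isClosedUnder hκ hκ' hF)
  refine hS₂ x hxS fun s hs hsc => ?_
  have hrx : ∀ a ∈ x ∩ A', r a ∈ x := fun a ha =>
    hxF {a} (by simpa using ha.1) (Or.inr ⟨a, ⟨by simp, ha.2⟩, rfl⟩)
  have hfx : ∀ a ∈ x ∩ Iio μ.ord, f a ∈ x := fun a ha =>
    hxF {a} (by simpa using ha.1) (Or.inl ⟨a, ⟨by simp, ha.2⟩, rfl⟩)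
  obtain ⟨η, hη, hηs⟩ := hS₁ x hxS (r '' s)
    (by rintro _ ⟨a, ha, rfl⟩; exact ⟨hrx a (hs ha), (hr a (hs ha).2).1⟩) (hsc.image r)
  refine ⟨f η, ⟨hfx η hη, (hf η hη.2).1⟩, fun a ha => ?_⟩
  obtain ⟨h, hle⟩ := hr a (hs ha).2
  exact hle.trans ((hf η hη.2).2 ⟨r a, h⟩ (hηs _ ⟨a, ha, rfl⟩)).le

theorem not_isStationaryIn_nonreflectingSet {κ lam : Cardinal.{u}} (hκ : κ.IsRegular)
    (hκ' : ℵ₀ < κ) {g : Ordinal.{u} → Ordinal.{u} → Ordinal.{u}}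
    (hg : ∀ δ < (Order.succ (Order.succ κ)).ord, ∀ a ≤ δ, ∃ ξ < (Order.succ κ).ord, g δ ξ = a)
    {A : Set Ordinal.{u}} (hA : Iio (Order.succ κ).ord ⊆ A)
    (hAcard : #A = Cardinal.lift.{u + 1} (Order.succ κ)) :
    ¬ IsStationaryIn κ A (nonreflectingSet κ lam g ∩ Pk κ A) := by
  have hsucc : (Order.succ κ).IsRegular := isRegular_succ hκ.aleph0_le
  have hΘ : (Order.succ (Order.succ κ)).IsRegular := isRegular_succ hsucc.aleph0_le
  set Θ := Order.succ (Order.succ κ)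
  have hκA : Iio κ.ord ⊆ A :=
    (Iio_subset_Iio (ord_le_ord.2 (Order.le_succ κ))).trans hA
  let A' := A ∩ Iio Θ.ord
  have hA'card : #A' ≤ Cardinal.lift.{u + 1} (Order.succ κ) :=
    hAcard ▸ mk_le_mk_of_subset inter_subset_left
  let M : Set Cardinal.{u + 1} := {m | ∃ B ⊆ A', (∀ a ∈ A', ∃ b ∈ B, a ≤ b) ∧ #B = m}
  have hM : M.Nonempty := ⟨_, A', subset_rfl, fun a ha => ⟨a, ha, le_rfl⟩, rfl⟩
  obtain ⟨B, hBA, hB, hBm⟩ := csInf_mem hM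
  have hmin : ∀ D ⊆ A', #D < sInf M → ∃ a ∈ A', ∀ b ∈ D, b < a := by
    intro D hD hDm
    by_contra! hcon
    exact notMem_of_lt_csInf' hDm ⟨D, hD, hcon, rfl⟩
  have hxA' : ∀ x ∈ nonreflectingSet κ lam g ∩ Pk κ A, x ∩ A' = x ∩ Iio Θ.ord := fun x hx => by
    ext a
    exact ⟨fun h => ⟨h.1, h.2.2⟩, fun h => ⟨h.1, hx.2.1 h.1, h.2⟩⟩
  have hS₂ : ∀ x ∈ nonreflectingSet κ lam g ∩ Pk κ A, ¬ IsCountablyDirected (x ∩ A') := by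
    intro x hx
    rw [hxA' x hx]
    exact hx.1.2.2.2.1
  obtain hlt | hge := lt_or_ge (sInf M) (Cardinal.lift.{u + 1} κ)
  · rintro ⟨-, hst⟩
    obtain ⟨ρ, hρ, hρA⟩ := exists_bound hΘ (s := A') inter_subset_right
      (hA'card.trans_lt (lift_lt.2 (Order.lt_succ _)))
    have hne : A'.Nonempty := ⟨0, hA hsucc.ord_pos, hΘ.ord_pos⟩
    have hlub : IsLUB A' (sSup A') := isLUB_csSup hne ⟨ρ, fun a ha => (hρA a ha).le⟩
    set δ := sSup A'
    have hδ : δ < Θ.ord := (hlub.2 fun a ha => (hρA a ha).le).trans_lt hρ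
    choose! ξ hξ hgξ using hg δ hδ
    -- The constant part `B` forces every closed `x` to be cofinal in `A'`; the part `ξ` puts `g
    -- δ`-preimages of its points into `x`.
    let F : Finset Ordinal.{u} → Set Ordinal.{u} := fun e => B ∪ ξ '' (↑e ∩ A')
    have hF : ∀ e, F e ∈ Pk κ A := by
      refine fun e => ⟨union_subset (hBA.trans inter_subset_left) ?_, ?_⟩
      · rintro _ ⟨a, ha, rfl⟩
        exact hA (hξ a (hlub.1 ha.2))
      · exact mk_union_lt (aleph0_lt_lift hκ').le (hBm ▸ hlt)
          (((e.finite_toSet.inter_of_left _).image _).lt_aleph0.trans (aleph0_lt_lift hκ'))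
    obtain ⟨x, hxS, hx, hxF⟩ := hst _ (isClubIn_isClosedUnder hκ hκ' hF)
    have hBx : B ⊆ x := subset_union_left.trans (hxF ∅ (by simp))
    refine hxS.1.2.2.2.2 δ ?_ ?_ <;> rw [← hxA' x hxS]
    · refine ⟨fun a ha => hlub.1 ha.2, fun b hb => hlub.2 fun a ha => ?_⟩
      obtain ⟨c, hc, hac⟩ := hB a ha
      exact hac.trans (hb ⟨hBx hc, hBA hc⟩)
    · intro a ha
      have haδ := hlub.1 ha.2
      exact ⟨ξ a, ⟨hxF {a} (by simpa using ha.1) (Or.inr ⟨a, ⟨by simp, ha.2⟩, rfl⟩), hξ a haδ⟩,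
        hgξ a haδ⟩
  · obtain heq | hgt := hge.eq_or_lt
    · rw [← heq] at hmin hBm
      exact not_isStationaryIn_of_isCountablyDirected hκ hκ' hκA inter_subset_left hBA hB hBm hmin
        hκ.aleph0_le (fun x hx => hx.1.2.1) hS₂
    · have heq : sInf M = Cardinal.lift.{u + 1} (Order.succ κ) := by
        refine le_antisymm (le_trans (csInf_le' ?_) hA'card) ?_
        · exact ⟨A', subset_rfl, fun a ha => ⟨a, ha, le_rfl⟩, rfl⟩
        · rw [Cardinal.lift_succ]
          exact Order.succ_le_of_lt hgt
      rw [heq] at hmin hBm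
      exact not_isStationaryIn_of_isCountablyDirected hκ hκ' hA inter_subset_left hBA hB hBm hmin
        hsucc.aleph0_le (fun x hx => hx.1.2.2.1) hS₂

/-! ### A game of length ω -/

/-- The list `[b (n - 1), …, b 0]`. -/
def initialList {α : Type v} (b : ℕ → α) : ℕ → List α
  | 0 => []
  | n + 1 => b n :: initialList b n

theorem initialList_succ_eq_append {α : Type v} (b : ℕ → α) (n : ℕ) :
    initialList b (n + 1) = initialList (fun k => b (k + 1)) n ++ [b 0] := by
  induction n with
  | zero => rfl
  | succ n ih => rw [initialList, ih]; rfl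

theorem mem_initialList {α : Type v} {b : ℕ → α} {n : ℕ} {a : α} :
    a ∈ initialList b n ↔ ∃ k < n, b k = a := by
  induction n with
  | zero => simp [initialList]
  | succ n ih =>
    simp only [initialList, List.mem_cons, ih, Nat.lt_succ_iff_lt_or_eq]
    constructor
    · rintro (rfl | ⟨k, hk, rfl⟩)
      exacts [⟨n, Or.inr rfl, rfl⟩, ⟨k, Or.inl hk, rfl⟩]
    · rintro ⟨k, hk | rfl, rfl⟩
      exacts [Or.inr ⟨k, hk, rfl⟩, Or.inl rfl]

/-- In the game of length `ω` below `Θ` continuing the position `p`, in which the first player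
demands lower bounds and the second player answers with ordinals above them, the first player has
a strategy ensuring that some position violates `P`. -/
def CanForceViolation (Θ : Ordinal.{u}) (P : List Ordinal.{u} → Prop) (p : List Ordinal.{u}) :
    Prop :=
  ∃ σ : List Ordinal.{u} → Ordinal.{u}, (∀ q, σ q < Θ) ∧
    ∀ b : ℕ → Ordinal.{u}, (∀ n, σ (initialList b n) ≤ b n ∧ b n < Θ) →
      ∃ n, ¬ P (initialList b n ++ p)

theorem holds_of_not_canForceViolation {Θ : Ordinal.{u}} (hΘ : 0 < Θ)
    {P : List Ordinal.{u} → Prop} {p : List Ordinal.{u}} (h : ¬ CanForceViolation Θ P p) : P p := by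
  by_contra hp
  exact h ⟨fun _ => 0, fun _ => hΘ, fun b _ => ⟨0, hp⟩⟩

/-- Otherwise the first player demands `α` and then follows a strategy chosen according to the
answer, which forces a violation from `p`. -/
theorem exists_not_canForceViolation_cons {Θ : Ordinal.{u}}
    {P : List Ordinal.{u} → Prop} {p : List Ordinal.{u}} (h : ¬ CanForceViolation Θ P p)
    {α : Ordinal.{u}} (hα : α < Θ) :
    ∃ β, α ≤ β ∧ β < Θ ∧ ¬ CanForceViolation Θ P (β :: p) := by
  by_contra! hcon
  have key : ∀ β : Ordinal.{u}, ∃ σ : List Ordinal.{u} → Ordinal.{u}, (∀ q, σ q < Θ) ∧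
      (α ≤ β → β < Θ →
        ∀ b : ℕ → Ordinal.{u}, (∀ n, σ (initialList b n) ≤ b n ∧ b n < Θ) →
          ∃ n, ¬ P (initialList b n ++ β :: p)) := by
    intro β
    by_cases hβ : α ≤ β ∧ β < Θ
    · obtain ⟨σ, h₁, h₂⟩ := hcon β hβ.1 hβ.2
      exact ⟨σ, h₁, fun _ _ => h₂⟩
    · exact ⟨fun _ => α, fun _ => hα, fun h₁ h₂ => absurd ⟨h₁, h₂⟩ hβ⟩
  choose σ hσ hσP using key
  -- Positions list the latest move first, so reversal exposes the opening answer `β`.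
  let rec' : List Ordinal.{u} → Ordinal.{u} := fun r =>
    match r with
    | [] => α
    | β :: t => σ β t.reverse
  refine h ⟨fun q => rec' q.reverse, fun q => ?_, fun b hb => ?_⟩
  · cases hq : q.reverse with
    | nil => simpa only [hq] using hα
    | cons β t => simpa only [hq] using hσ β t.reverse
  · obtain ⟨n, hn⟩ := hσP (b 0) (hb 0).1 (hb 0).2 (fun k => b (k + 1)) fun n => by
      refine ⟨?_, (hb (n + 1)).2⟩
      have := (hb (n + 1)).1
      rw [initialList_succ_eq_append] at this
      simpa [rec'] using this
    refine ⟨n + 1, ?_⟩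
    rw [initialList_succ_eq_append, List.append_assoc]
    exact hn

/-- If fewer than `Θ` conditions are such that every `ω`-sequence below `Θ` satisfies one of them
at all positions, then for one of them no violation can be forced. -/
theorem exists_not_canForceViolation {Θ : Cardinal.{u}} (hΘ : Θ.IsRegular) {ι : Type (u + 1)}
    {Y : Set ι} (hY : #Y < Cardinal.lift.{u + 1} Θ) {P : ι → List Ordinal.{u} → Prop}
    (h : ∀ b : ℕ → Ordinal.{u}, (∀ n, b n < Θ.ord) → ∃ y ∈ Y, ∀ n, P y (initialList b n)) :
    ∃ y ∈ Y, ¬ CanForceViolation Θ.ord (P y) [] := by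
  by_contra! hcon
  choose! σ hσ hσP using hcon
  -- By regularity one answer meets the demands of all the strategies at once, so a single play
  -- obeys every one of them.
  have hB : ∀ q, ∃ β < Θ.ord, ∀ a ∈ (fun y => σ y q) '' Y, a < β := fun q =>
    exists_bound hΘ (by rintro _ ⟨y, hy, rfl⟩; exact hσ y hy q) (mk_image_le.trans_lt hY)
  choose B hBΘ hB using hB
  let L : ℕ → List Ordinal.{u} := fun n => (fun l => B l :: l)^[n] []
  have hL : ∀ n, initialList (fun n => B (L n)) n = L n := by
    intro n
    induction n with
    | zero => rfl
    | succ n ih =>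
      rw [initialList, ih]
      exact (Function.iterate_succ_apply' (fun l => B l :: l) n []).symm
  obtain ⟨y, hy, hyP⟩ := h (fun n => B (L n)) fun n => hBΘ _
  obtain ⟨n, hn⟩ := hσP y hy (fun n => B (L n)) fun n => by
    refine ⟨?_, hBΘ _⟩
    rw [hL]
    exact (hB _ _ ⟨y, hy, rfl⟩).le
  rw [List.append_nil] at hn
  exact hn (hyP n)

/-! ### Traces on κ⁺ -/

/-- A family of at most `κ⁺` small subsets of `κ⁺`, obtained from surjections `h γ` of `κ` onto
the ordinals `γ` below `κ⁺`. -/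
def traces (κ : Cardinal.{u}) (h : Ordinal.{u} → Ordinal.{u} → Ordinal.{u}) :
    Set (Set Ordinal.{u}) :=
  {y | ∃ γ < (Order.succ κ).ord, ∃ ε < κ.ord, y = h γ '' Iio ε ∩ Iio γ ∧
    IsCountablyDirected y ∧ IsCountablyDirected (y ∩ Iio κ.ord)}

theorem mk_traces_lt {κ : Cardinal.{u}} (hκ : ℵ₀ ≤ κ)
    (h : Ordinal.{u} → Ordinal.{u} → Ordinal.{u}) :
    #(traces κ h) < Cardinal.lift.{u + 1} (Order.succ (Order.succ κ)) := by
  have hsub : traces κ h ⊆ range fun p : Iio (Order.succ κ).ord × Iio κ.ord =>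
      h p.1.1 '' Iio p.2.1 ∩ Iio p.1.1 := by
    rintro y ⟨γ, hγ, ε, hε, rfl, -⟩
    exact ⟨⟨⟨γ, hγ⟩, ⟨ε, hε⟩⟩, rfl⟩
  refine ((mk_le_mk_of_subset hsub).trans mk_range_le).trans_lt ?_
  rw [mk_prod, Cardinal.lift_id, Cardinal.lift_id, mk_Iio_ord, mk_Iio_ord]
  have hsucc := hκ.trans (Order.le_succ κ)
  refine mul_lt_of_lt ?_ (lift_lt.2 (Order.lt_succ _))
    (lift_lt.2 ((Order.lt_succ κ).trans (Order.lt_succ _)))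
  rw [aleph0_le_lift]
  exact hsucc.trans (Order.le_succ _)

theorem mk_lt_of_mem_traces {κ : Cardinal.{u}} {h : Ordinal.{u} → Ordinal.{u} → Ordinal.{u}}
    {y : Set Ordinal.{u}} (hy : y ∈ traces κ h) : #y < Cardinal.lift.{u + 1} κ := by
  obtain ⟨γ, hγ, ε, hε, rfl, -⟩ := hy
  exact ((mk_le_mk_of_subset inter_subset_left).trans mk_image_le).trans_lt (mk_Iio_lt_lift hε)

theorem subset_of_mem_traces {κ : Cardinal.{u}} {h : Ordinal.{u} → Ordinal.{u} → Ordinal.{u}}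
    {y : Set Ordinal.{u}} (hy : y ∈ traces κ h) : y ⊆ Iio (Order.succ κ).ord := by
  obtain ⟨γ, hγ, ε, hε, rfl, -⟩ := hy
  exact inter_subset_right.trans (Iio_subset_Iio hγ.le)

/-- Two closure arguments: first `γ` below `κ⁺`, closed under suprema of hulls, then `ε` below `κ`,
closed for the enumeration of `γ`. -/
theorem exists_trace {ν κ : Cardinal.{u}} (hν : ν.IsRegular) (hν' : ℵ₀ < ν) (hκ : κ.IsRegular)
    (hνκ : ν < κ) {h : Ordinal.{u} → Ordinal.{u} → Ordinal.{u}}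
    (hh : ∀ γ < (Order.succ κ).ord, ∀ a < γ, ∃ ξ < κ.ord, h γ ξ = a)
    {F : Finset Ordinal.{u} → Set Ordinal.{u}} (hF : ∀ e, #(F e) < Cardinal.lift.{u + 1} κ)
    {b : Set Ordinal.{u}} (hb : b.Countable) :
    ∃ y ∈ traces κ h, hull F (b ∪ y) ∩ Iio (Order.succ κ).ord ⊆ y := by
  have hκ' : ℵ₀ < κ := hν'.trans hνκ
  have hκl := IsRegular.lift.{u + 1} hκ
  have h0 := aleph0_lt_lift hκ'
  have hsucc : (Order.succ κ).IsRegular := isRegular_succ hκ.aleph0_le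
  have hsuccl := IsRegular.lift.{u + 1} hsucc
  have hlt : Cardinal.lift.{u + 1} κ < Cardinal.lift.{u + 1} (Order.succ κ) :=
    lift_lt.2 (Order.lt_succ κ)
  have hbκ : #b < Cardinal.lift.{u + 1} κ := (mk_le_aleph0_iff.2 hb.to_subtype).trans_lt h0
  have hf₁ : ∀ ρ : Ordinal.{u}, ∃ σ, ρ < (Order.succ κ).ord → σ < (Order.succ κ).ord ∧
      ∀ a ∈ hull F (b ∪ Iio ρ) ∩ Iio (Order.succ κ).ord, a < σ := by
    intro ρ
    by_cases hρ : ρ < (Order.succ κ).ord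
    · obtain ⟨σ, hσ, hσ'⟩ := exists_bound hsucc
        (s := hull F (b ∪ Iio ρ) ∩ Iio (Order.succ κ).ord) inter_subset_right
        ((mk_le_mk_of_subset inter_subset_left).trans_lt (mk_hull_lt hsuccl (h0.trans hlt)
          (fun e => (hF e).trans hlt)
          (mk_union_lt (h0.trans hlt).le (hbκ.trans hlt) (mk_Iio_lt_lift hρ))))
      exact ⟨σ, fun _ => ⟨hσ, hσ'⟩⟩
    · exact ⟨0, fun h => absurd h hρ⟩
  choose f₁ hf₁ using hf₁
  -- Cofinality `κ` bounds each small `y ε` below `γ`, so its hull stays below `γ` within `κ⁺`.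
  obtain ⟨γ, hγ, hκγ, hγcof, hγf⟩ := exists_closure_point hκ hsucc (Order.lt_succ κ)
    (fun ρ hρ => (hf₁ ρ hρ).1) (ord_lt_ord.2 (Order.lt_succ κ))
  choose! ξ hξ hhξ using hh γ hγ
  let y : Ordinal.{u} → Set Ordinal.{u} := fun ε => h γ '' Iio ε ∩ Iio γ
  have hymono : Monotone y := fun ε η hεη =>
    inter_subset_inter_left _ (image_mono (Iio_subset_Iio hεη))
  have hycard : ∀ ε < κ.ord, #(y ε) < Cardinal.lift.{u + 1} κ := fun ε hε =>
    ((mk_le_mk_of_subset inter_subset_left).trans mk_image_le).trans_lt (mk_Iio_lt_lift hε)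
  have hf₂ : ∀ ε : Ordinal.{u}, ∃ η, ε < κ.ord → η < κ.ord ∧
      hull F (b ∪ y ε) ∩ Iio (Order.succ κ).ord ⊆ y η ∧ (∃ ρ ∈ y η, ∀ a ∈ y ε, a < ρ) ∧
      ∃ ρ ∈ y η ∩ Iio κ.ord, ∀ a ∈ y ε ∩ Iio κ.ord, a < ρ := by
    intro ε
    by_cases hε : ε < κ.ord
    · obtain ⟨ρ, hρ, hρy⟩ := exists_bound_of_cof (γ := γ) (s := y ε) inter_subset_right
        (by rw [hγcof]; exact hycard ε hε)
      obtain ⟨τ, hτ, hτy⟩ := exists_bound hκ (s := y ε ∩ Iio κ.ord) inter_subset_right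
        ((mk_le_mk_of_subset inter_subset_left).trans_lt (hycard ε hε))
      have hT : hull F (b ∪ y ε) ∩ Iio (Order.succ κ).ord ⊆ Iio γ := by
        intro a ha
        refine ((hf₁ ρ (hρ.trans hγ)).2 a ⟨?_, ha.2⟩).trans (hγf ρ hρ)
        exact hull_mono F (union_subset_union_right b hρy) ha.1
      -- Besides the hull, the next stage absorbs the bounds `ρ` and `τ`, which give directedness of
      -- the limit and of its part below `κ`.
      let U : Set Ordinal.{u} := hull F (b ∪ y ε) ∩ Iio (Order.succ κ).ord ∪ {ρ, τ}
      have hU : U ⊆ Iio γ := union_subset hT (by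
        rintro a (rfl | rfl)
        exacts [hρ, hτ.trans hκγ])
      have hUcard : #U < Cardinal.lift.{u + 1} κ :=
        mk_union_lt h0.le ((mk_le_mk_of_subset inter_subset_left).trans_lt
          (mk_hull_lt hκl h0 hF (mk_union_lt h0.le hbκ (hycard ε hε))))
          ((toFinite _).lt_aleph0.trans h0)
      obtain ⟨η, hη, hηU⟩ := exists_bound hκ (s := ξ '' U)
        (by rintro _ ⟨a, ha, rfl⟩; exact hξ a (hU ha)) (mk_image_le.trans_lt hUcard)
      have hUy : U ⊆ y η := fun a ha =>
        ⟨⟨ξ a, hηU _ ⟨a, ha, rfl⟩, hhξ a (hU ha)⟩, hU ha⟩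
      exact ⟨η, fun _ => ⟨hη, subset_union_left.trans hUy,
        ⟨ρ, hUy (Or.inr (Or.inl rfl)), hρy⟩, τ, ⟨hUy (Or.inr (Or.inr rfl)), hτ⟩, hτy⟩⟩
    · exact ⟨0, fun h => absurd h hε⟩
  choose f₂ hf₂ using hf₂
  -- The uncountable cofinality `ν` makes every countable subset of `y ε` appear at an earlier
  -- stage.
  obtain ⟨ε, hε, hε0, hεcof, hεf⟩ := exists_closure_point hν hκ hνκ
    (fun ρ hρ => (hf₂ ρ hρ).1) hκ.ord_pos
  have hεlim : Order.IsSuccLimit ε := one_lt_cof_iff.1 (hεcof ▸ one_lt_aleph0.trans hν')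
  have hpt : ∀ a ∈ y ε, ∃ η < ε, a ∈ y η := by
    rintro _ ⟨⟨ζ, hζ, rfl⟩, ha⟩
    exact ⟨Order.succ ζ, hεlim.succ_lt hζ, ⟨ζ, mem_Iio.2 (Order.lt_succ ζ), rfl⟩, ha⟩
  choose! i hi hyi using hpt
  have hcount : ∀ s ⊆ y ε, s.Countable → ∃ η < ε, s ⊆ y η := by
    intro s hs hsc
    obtain ⟨η, hη, hηs⟩ := exists_bound_of_cof (γ := ε) (s := i '' s)
      (by rintro _ ⟨a, ha, rfl⟩; exact hi a (hs ha)) (by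
        rw [hεcof]
        exact (mk_le_aleph0_iff.2 (hsc.image i).to_subtype).trans_lt (aleph0_lt_lift hν'))
    exact ⟨η, hη, fun a ha => hymono (hηs _ ⟨a, ha, rfl⟩).le (hyi a (hs ha))⟩
  have hstep : ∀ η < ε, y (f₂ η) ⊆ y ε := fun η hη => hymono (hεf η hη).le
  refine ⟨y ε, ⟨γ, hγ, ε, hε, rfl, ?_, ?_⟩, ?_⟩
  · intro s hs hsc
    obtain ⟨η, hη, hsη⟩ := hcount s hs hsc
    obtain ⟨ρ, hρ, hρy⟩ := (hf₂ η (hη.trans hε)).2.2.1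
    exact ⟨ρ, hstep η hη hρ, fun a ha => (hρy a (hsη ha)).le⟩
  · intro s hs hsc
    obtain ⟨η, hη, hsη⟩ := hcount s (hs.trans inter_subset_left) hsc
    obtain ⟨ρ, hρ, hρy⟩ := (hf₂ η (hη.trans hε)).2.2.2
    exact ⟨ρ, ⟨hstep η hη hρ.1, hρ.2⟩, fun a ha => (hρy a ⟨hsη ha, (hs ha).2⟩).le⟩
  · have hcl : IsClosedUnder F (⋃₀ ((fun η => hull F (b ∪ y η)) '' Iio ε)) := by
      refine isClosedUnder_sUnion ⟨_, 0, hε0, rfl⟩ ?_ ?_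
      · rintro _ ⟨η, hη, rfl⟩ _ ⟨ζ, hζ, rfl⟩
        refine ⟨_, ⟨max η ζ, mem_Iio.2 (max_lt hη hζ), rfl⟩, ?_, ?_⟩
        · exact hull_mono F (union_subset_union_right b (hymono (le_max_left _ _)))
        · exact hull_mono F (union_subset_union_right b (hymono (le_max_right _ _)))
      · rintro _ ⟨η, hη, rfl⟩
        exact isClosedUnder_hull F _
    have hsub : hull F (b ∪ y ε) ⊆ ⋃₀ ((fun η => hull F (b ∪ y η)) '' Iio ε) := by
      refine hull_subset hcl (union_subset (fun a ha => ?_) fun a ha => ?_)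
      · exact ⟨_, ⟨0, hε0, rfl⟩, subset_hull F _ (Or.inl ha)⟩
      · exact ⟨_, ⟨i a, hi a ha, rfl⟩, subset_hull F _ (Or.inr (hyi a ha))⟩
    rintro a ⟨ha, haκ⟩
    obtain ⟨_, ⟨η, hη, rfl⟩, haη⟩ := hsub ha
    exact hstep η hη ((hf₂ η (lt_trans hη hε)).2.1 ⟨haη, haκ⟩)

/-! ### Stationarity of the witness -/

/-- The bound serves all positions below `ρ` simultaneously, so iterating it gives a sequence
independent of the play. -/
theorem exists_position_bound {Θ : Cardinal.{u}} (hΘ : Θ.IsRegular) (hΘ' : ℵ₀ < Θ)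
    {F : Finset Ordinal.{u} → Set Ordinal.{u}} (hF : ∀ e, #(F e) < Cardinal.lift.{u + 1} Θ)
    {W : List Ordinal.{u} → Prop} {τ : List Ordinal.{u} → Ordinal.{u} → Ordinal.{u}}
    (hτ : ∀ p, W p → ∀ ρ < Θ.ord, τ p ρ < Θ.ord) {ρ : Ordinal.{u}} (hρ : ρ < Θ.ord) :
    ∃ σ < Θ.ord, (∀ a ∈ hull F (Iio ρ) ∩ Iio Θ.ord, a < σ) ∧
      ∀ p, W p → (∀ a ∈ p, a < ρ) → τ p ρ < σ := by
  have hΘl := IsRegular.lift.{u + 1} hΘ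
  have h0 := aleph0_lt_lift hΘ'
  have hρl := mk_Iio_lt_lift hρ
  let T : Set Ordinal.{u} := (fun p => τ p ρ) '' {p | W p ∧ ∀ a ∈ p, a < ρ}
  have hlist : #{p : List Ordinal.{u} | W p ∧ ∀ a ∈ p, a < ρ} < Cardinal.lift.{u + 1} Θ := by
    have hsub : {p : List Ordinal.{u} | W p ∧ ∀ a ∈ p, a < ρ} ⊆
        range fun l : List (Iio ρ) => l.map Subtype.val := by
      rintro p ⟨-, hp⟩
      exact ⟨p.attach.map fun a => ⟨a.1, hp _ a.2⟩, by simp⟩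
    exact ((mk_le_mk_of_subset hsub).trans mk_range_le).trans_lt
      ((mk_list_le_max _).trans_lt (max_lt h0 hρl))
  obtain ⟨σ, hσ, hσ'⟩ := exists_bound hΘ (s := hull F (Iio ρ) ∩ Iio Θ.ord ∪ T)
    (union_subset inter_subset_right (by rintro _ ⟨p, hp, rfl⟩; exact hτ p hp.1 ρ hρ))
    (mk_union_lt h0.le ((mk_le_mk_of_subset inter_subset_left).trans_lt
      (mk_hull_lt hΘl h0 hF hρl)) (mk_image_le.trans_lt hlist))
  exact ⟨σ, hσ, fun a ha => hσ' a (Or.inl ha), fun p hp hpρ => hσ' _ (Or.inr ⟨p, ⟨hp, hpρ⟩, rfl⟩)⟩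

theorem isStationaryIn_nonreflectingSet {ν κ lam : Cardinal.{u}} (hν : ν.IsRegular)
    (hν' : ℵ₀ < ν) (hκ : κ.IsRegular) (hνκ : ν < κ) (hlam : Order.succ (Order.succ κ) ≤ lam)
    (g : Ordinal.{u} → Ordinal.{u} → Ordinal.{u}) :
    IsStationaryIn κ (Iio lam.ord) (nonreflectingSet κ lam g) := by
  refine ⟨fun x hx => hx.1, fun C hC => ?_⟩
  have hκ' : ℵ₀ < κ := hν'.trans hνκ
  have hκl := IsRegular.lift.{u + 1} hκ
  have h0 := aleph0_lt_lift hκ'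
  have hΘ : (Order.succ (Order.succ κ)).IsRegular :=
    isRegular_succ (hκ.aleph0_le.trans (Order.le_succ κ))
  set Θ := Order.succ (Order.succ κ)
  have hκs : Order.succ κ < Θ := Order.lt_succ _
  have hκΘ : κ < Θ := (Order.lt_succ κ).trans hκs
  have hκΘl : Cardinal.lift.{u + 1} κ < Cardinal.lift.{u + 1} Θ := lift_lt.2 hκΘ
  obtain ⟨F, hF, hFC⟩ := hC.exists_operation hκ hκ'
  obtain ⟨h, hh⟩ := exists_surjections κ
  let P : Set Ordinal.{u} → List Ordinal.{u} → Prop := fun y p =>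
    hull F ({a | a ∈ p} ∪ y) ∩ Iio (Order.succ κ).ord ⊆ y
  obtain ⟨y, hy, hyW⟩ := exists_not_canForceViolation hΘ (mk_traces_lt hκ.aleph0_le h) (P := P) (by
    intro b _
    obtain ⟨y, hy, hyb⟩ := exists_trace hν hν' hκ hνκ hh (fun e => (hF e).2) (countable_range b)
    refine ⟨y, hy, fun n => (inter_subset_inter_left _ (hull_mono F
      (union_subset_union_left _ ?_))).trans hyb⟩
    intro a ha
    obtain ⟨k, -, rfl⟩ := mem_initialList.1 ha
    exact mem_range_self k)
  let W : List Ordinal.{u} → Prop := fun p => ¬ CanForceViolation Θ.ord (P y) p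
  have hWP : ∀ p, W p → P y p := fun p hp => holds_of_not_canForceViolation hΘ.ord_pos hp
  have hext : ∀ p, W p → ∀ α < Θ.ord, ∃ β, α ≤ β ∧ β < Θ.ord ∧ W (β :: p) :=
    fun p hp α hα => exists_not_canForceViolation_cons hp hα
  choose! τ hτle hτlt hτW using hext
  have hyκ := mk_lt_of_mem_traces hy
  have hysub := subset_of_mem_traces hy
  have hB₀ : Cardinal.lift.{u + 1} κ ≤ #{β : Ordinal.{u} | β < Θ.ord ∧ W [β]} := by
    by_contra! hlt
    obtain ⟨ρ, hρ, hρ'⟩ := exists_bound hΘ (s := {β : Ordinal.{u} | β < Θ.ord ∧ W [β]})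
      (fun β hβ => hβ.1) (hlt.trans hκΘl)
    exact (hτle [] hyW ρ hρ).not_gt (hρ' _ ⟨hτlt [] hyW ρ hρ, hτW [] hyW ρ hρ⟩)
  obtain ⟨B, hBsub, hBcard⟩ := le_mk_iff_exists_subset.1 hB₀
  -- `d₀` exceeds all candidate first moves and `κ⁺`, so the sequence `d` and its supremum `δ` are
  -- fixed before `β` is chosen.
  obtain ⟨d₀, hd₀, hBd⟩ := exists_bound hΘ (s := B ∪ {(Order.succ κ).ord})
    (union_subset (fun β hβ => (hBsub hβ).1) (by simpa using hκs))
    (mk_union_lt (h0.trans hκΘl).le (hBcard ▸ hκΘl)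
      ((toFinite _).lt_aleph0.trans (h0.trans hκΘl)))
  choose! f hfΘ hfhull hfτ using fun (ρ : Ordinal.{u}) (hρ : ρ < Θ.ord) =>
    exists_position_bound hΘ (hκ'.trans hκΘ) (fun e => (hF e).2.trans hκΘl) hτlt hρ
  have hfle : ∀ ρ < Θ.ord, ρ ≤ f ρ := by
    intro ρ hρ
    refine le_of_forall_lt fun a ha => hfhull ρ hρ a ⟨subset_hull F _ ha, ha.trans hρ⟩
  let d : ℕ → Ordinal.{u} := fun n => f^[n] d₀
  have hdsucc : ∀ n, d (n + 1) = f (d n) := fun n => Function.iterate_succ_apply' f n d₀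
  have hdΘ : ∀ n, d n < Θ.ord := by
    intro n
    induction n with
    | zero => exact hd₀
    | succ n ih => rw [hdsucc]; exact hfΘ _ ih
  have hdmono : Monotone d := monotone_nat_of_le_succ fun n => by
    rw [hdsucc]; exact hfle _ (hdΘ n)
  have hdlub : IsLUB (range d) (sSup (range d)) :=
    isLUB_csSup (range_nonempty d) ⟨Θ.ord, by rintro _ ⟨n, rfl⟩; exact (hdΘ n).le⟩
  set δ := sSup (range d)
  obtain ⟨β, hβB, hβg⟩ : ∃ β ∈ B, β ∉ g δ '' y := by
    by_contra! hcon
    exact ((mk_le_mk_of_subset hcon).trans mk_image_le).not_gt (hBcard ▸ hyκ)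
  -- The move at stage `n` lies in `[d n, d (n + 1))`, so the moves are cofinal in `δ`.
  let p : ℕ → List Ordinal.{u} := fun n =>
    Nat.rec [β] (fun n l => τ l (d n) :: l) n
  have hp : ∀ n, W (p n) ∧ ∀ a ∈ p n, a < d n := by
    intro n
    induction n with
    | zero => exact ⟨(hBsub hβB).2, fun a ha => by
        rw [List.mem_singleton.1 ha]
        exact hBd β (Or.inl hβB)⟩
    | succ n ih =>
      refine ⟨hτW _ ih.1 _ (hdΘ n), fun a ha => ?_⟩
      obtain rfl | ha := List.mem_cons.1 ha
      · rw [hdsucc]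
        exact hfτ _ (hdΘ n) _ ih.1 ih.2
      · exact (ih.2 a ha).trans_le (hdmono n.le_succ)
  let z : ℕ → Set Ordinal.{u} := fun n => {a | a ∈ p n} ∪ y
  have hz : Monotone z := monotone_nat_of_le_succ fun n =>
    union_subset_union_left _ fun a ha => List.mem_cons_of_mem _ ha
  have hzd : ∀ n, z n ⊆ Iio (d n) := fun n => union_subset (hp n).2 fun a ha =>
    ((hysub ha).trans (hBd _ (Or.inr rfl))).trans_le (hdmono n.zero_le)
  let x : Set Ordinal.{u} := hull F (⋃ n, z n)
  have hx : x = ⋃ n, hull F (z n) := hull_iUnion_nat F hz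
  have hzx : ∀ n, z n ⊆ x := fun n => (subset_iUnion z n).trans (subset_hull F _)
  have hyx : y ⊆ x := subset_union_right.trans (hzx 0)
  have hxPk : x ∈ Pk κ (Iio lam.ord) := by
    refine ⟨hull_subset (fun e _ => (hF e).1) (iUnion_subset fun n => (hzd n).trans
      (Iio_subset_Iio ((hdΘ n).le.trans (ord_le_ord.2 hlam)))), mk_hull_lt hκl h0
      (fun e => (hF e).2) (mk_iUnion_nat_lt hκl h0 fun n => mk_union_lt h0.le ?_ hyκ)⟩
    exact (p n).finite_toSet.lt_aleph0.trans h0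
  have hxκ : x ∩ Iio (Order.succ κ).ord = y := by
    refine subset_antisymm ?_ (subset_inter hyx hysub)
    rintro a ⟨ha, haκ⟩
    rw [hx] at ha
    obtain ⟨n, hn⟩ := mem_iUnion.1 ha
    exact hWP _ (hp n).1 ⟨hn, haκ⟩
  have hxd : ∀ a ∈ x ∩ Iio Θ.ord, ∃ n, a < d n := by
    rintro a ⟨ha, haΘ⟩
    rw [hx] at ha
    obtain ⟨n, hn⟩ := mem_iUnion.1 ha
    refine ⟨n + 1, ?_⟩
    rw [hdsucc]
    exact hfhull _ (hdΘ n) a ⟨hull_mono F (hzd n) hn, haΘ⟩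
  have hτx : ∀ n, τ (p n) (d n) ∈ x ∩ Iio Θ.ord := fun n =>
    ⟨hzx (n + 1) (Or.inl List.mem_cons_self), hτlt _ (hp n).1 _ (hdΘ n)⟩
  have hτd : ∀ n, d n ≤ τ (p n) (d n) := fun n => hτle _ (hp n).1 _ (hdΘ n)
  have hlub : IsLUB (x ∩ Iio Θ.ord) δ := by
    refine ⟨fun a ha => ?_, fun c hc => hdlub.2 ?_⟩
    · obtain ⟨n, hn⟩ := hxd a ha
      exact hn.le.trans (hdlub.1 ⟨n, rfl⟩)
    · rintro _ ⟨n, rfl⟩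
      exact (hτd n).trans (hc (hτx n))
  have hycd : IsCountablyDirected y ∧ IsCountablyDirected (y ∩ Iio κ.ord) := by
    obtain ⟨γ, -, ε, -, -, h₁, h₂⟩ := hy
    exact ⟨h₁, h₂⟩
  refine ⟨x, ⟨hxPk, ?_, ?_, ?_, ?_⟩, hFC x hxPk (isClosedUnder_hull F _)⟩
  · have : x ∩ Iio κ.ord = y ∩ Iio κ.ord := by
      rw [← hxκ, inter_assoc, Iio_inter_Iio, min_eq_right (ord_le_ord.2 (Order.le_succ κ))]
    rw [this]
    exact hycd.2
  · rw [hxκ]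
    exact hycd.1
  -- A bound for the moves inside `x` would lie below some `d n`, hence below the move at stage `n`.
  · intro hcd
    obtain ⟨ρ, hρ, hρτ⟩ := hcd (range fun n => τ (p n) (d n))
      (by rintro _ ⟨n, rfl⟩; exact hτx n) (countable_range _)
    obtain ⟨n, hn⟩ := hxd ρ hρ
    exact (hn.trans_le ((hτd n).trans (hρτ _ ⟨n, rfl⟩))).false
  · intro δ' hδ' hsub
    rw [hδ'.unique hlub, hxκ] at hsub
    exact hβg (hsub ⟨hzx 0 (Or.inl (List.mem_singleton_self β)), (hBsub hβB).1⟩)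

end PkLambda

/-- The witness is `nonreflectingSet`. Its stationarity rests on a game of length `ω` on `κ⁺⁺`, whose
position conditions range over a family of only `κ⁺` traces on `κ⁺`; for this it is enough that `ν`
is a regular cardinal strictly between `ℵ₀` and `κ`, and `hcf` is not needed. -/
theorem mainTheorem4 (ν κ lam : Cardinal.{u})
    (hν : ν.IsRegular) (hν_unc : Cardinal.aleph0 < ν)
    (hκ : κ.IsRegular) (hνκ : ν < κ)
    (hlam : Order.succ (Order.succ κ) ≤ lam)
    (hcf : ∀ γ : Ordinal.{u}, ν.ord < γ → γ < κ.ord →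
      PkLambda.cf ν γ < Cardinal.lift.{u + 1, u} κ) :
    ∃ S : Set (Set Ordinal.{u}),
      PkLambda.IsNonreflectingStationary κ lam (Order.succ κ) S := by
  obtain ⟨g, hg⟩ := PkLambda.exists_surjections (Order.succ κ)
  have hlim := isSuccLimit_ord (isRegular_succ (hκ.aleph0_le.trans (Order.le_succ κ))).aleph0_le
  -- The shift to the successor makes the map reach `δ` itself, since `A ∩ κ⁺⁺` may contain its
  -- supremum.
  exact ⟨PkLambda.nonreflectingSet κ lam fun δ => g (Order.succ δ),
    PkLambda.isStationaryIn_nonreflectingSet hν hν_unc hκ hνκ hlam _,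
    fun A hA _ hAcard => PkLambda.not_isStationaryIn_nonreflectingSet hκ (hν_unc.trans hνκ)
      (fun δ hδ a ha => hg _ (hlim.succ_lt hδ) a (Order.lt_succ_of_le ha)) hA hAcard⟩
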